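/- For $B>0$ let $L^2_{\mathbb C}([0,B])$ be the space of square integrable complex functions on the frequency band $[0,B]$. For $0<\sigma<B_N$ and $n\in\mathbb N$ let $\mathcal A_n=\mathcal A_n(B_N,\sigma)\subset L^2_{\mathbb C}([0,B_N])$ be the set of restrictions to $[0,B_N]$ of the Fourier transforms $\hat x$ of real valued $x\in L^2(\mathbb R)$ for which there is a set $S\subset[0,B_N]$ (depending on $x$) such that $S$ is a union of at most $n$ intervals, $|S|\le\sigma$ (Lebesgue measure), and $\hat x=0$ almost everywhere outside $S\cup(-S)$. Put $\mathcal A=\bigcup_{n}\mathcal A_n$. A bounded linear map $\Phi$ between Hilbert spaces is called bi-Lipschitz on a set $A$ with constants $0<\alpha\le\beta$ if $$\alpha\|X_1-X_2\|^2\le\|\Phi(X_1-X_2)\|^2\le\beta\|X_1-X_2\|^2\qquad\text{for all }X_1,X_2\in A.$$ There are absolute constants $c>0$ and $0<\alpha\le\beta$ such that, for all $B_N,B_M,\sigma$ with $0<\sigma<B_N$ and $$B_M\ \ge\ c\,\sigma\ln\!\left(\frac{B_N}{\sigma}\right),$$ the following hold. 1. There is a bounded linear map $\Phi:L^2_{\mathbb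 C}([0,B_N])\to L^2_{\mathbb C}([0,B_M])$ that is bi-Lipschitz on $\mathcal A$ with constants $\alpha,\beta$. 2. If moreover $2\sigma\le B_N$, then for every $n\ge1$ there is such an embedding of $\mathcal A_n$, with the same constants $\alpha,\beta$, that acts by mixing blocks of the spectrum of length $b=\sigma/n$: with $N=\lceil B_N/b\rceil$ there are an integer $M\ge 0$ with $Mb\le B_M$ and a real matrix $G\in\mathbb R^{M\times N}$ such that the bounded linear map $\Phi:L^2_{\mathbb C}([0,B_N])\to L^2_{\mathbb C}([0,B_M])$ given by $$(\Phi X)(ib+f)=\sum_{j=0}^{N-1}G_{ij}\,X(jb+f)\qquad(0\le i<M,\ \text{a.e. } f\in[0,b)),\qquad \Phi X=0\ \text{ a.e. on }(Mb,B_M],$$ where $X$ is extended by zero outside $[0,B_N]$, is bi-Lipschitz on $\mathcal A_n$ with constants $\alpha,\beta$. -/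

import Mathlib

open MeasureTheory Set
open scoped FourierTransform

/-- The Hilbert space of square integrable complex functions on the frequency band `[0, B]`. -/
abbrev BandL2 (B : ℝ) : Type :=
  Lp ℂ 2 ((volume : Measure ℝ).restrict (Icc 0 B))

/-- `S` is a union of at most `n` bounded intervals. (Some of the `n` intervals may be empty or
overlap; the choice of closed end points only matters up to null sets.) -/
def IsIntervalUnion (n : ℕ) (S : Set ℝ) : Prop :=
  ∃ a b : Fin n → ℝ, S = ⋃ i, Icc (a i) (b i)

/-- `X` is the Fourier transform, restricted to the positive band `[0, B]`, of a real valued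
square integrable signal `x` whose Fourier transform vanishes (almost everywhere) outside
`S ∪ -S`. -/
def IsSignalSpectrum (B : ℝ) (S : Set ℝ) (X : BandL2 B) : Prop :=
  ∃ x : Lp ℂ 2 (volume : Measure ℝ),
    (∀ᵐ t, (x t).im = 0) ∧
    (∀ᵐ f, f ∉ S → -f ∉ S → (𝓕 x : Lp ℂ 2 (volume : Measure ℝ)) f = 0) ∧
    (∀ᵐ f ∂((volume : Measure ℝ).restrict (Icc 0 B)),
      X f = (𝓕 x : Lp ℂ 2 (volume : Measure ℝ)) f)

/-- The union of subspaces of the real signals, represented by their positive spectra in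
`L²([0, B])`, whose positive Fourier support `S ⊆ [0, B]` is a union of at most `n` intervals
and has Lebesgue measure at most `σ`. The set `S` may be different for different signals. -/
def sparseSpectra (B σ : ℝ) (n : ℕ) : Set (BandL2 B) :=
  {X | ∃ S : Set ℝ, IsIntervalUnion n S ∧ S ⊆ Icc 0 B ∧ volume S ≤ ENNReal.ofReal σ ∧
    IsSignalSpectrum B S X}

/-- The bounded linear map `Φ` is bi-Lipschitz on the set `A`, with constants `α ≤ β` for the
squared norms. -/
def IsBiLipschitzOn {H L : Type*} [NormedAddCommGroup H] [NormedSpace ℂ H]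
    [NormedAddCommGroup L] [NormedSpace ℂ L] (Φ : H →L[ℂ] L) (A : Set H) (α β : ℝ) : Prop :=
  0 < α ∧ α ≤ β ∧ ∀ x₁ ∈ A, ∀ x₂ ∈ A,
    α * ‖x₁ - x₂‖ ^ 2 ≤ ‖Φ (x₁ - x₂)‖ ^ 2 ∧ ‖Φ (x₁ - x₂)‖ ^ 2 ≤ β * ‖x₁ - x₂‖ ^ 2

/-- The function on the whole line that agrees with `X` on `[0, B]` and is zero elsewhere. -/
noncomputable def BandL2.extend {B : ℝ} (X : BandL2 B) : ℝ → ℂ :=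
  (Icc 0 B).indicator (fun f => X f)

/-- `Φ` is the spectrum mixing operator of the real matrix `G`, with blocks of length `b`: the
input band `[0, B]` is cut into `N = ⌈B / b⌉` consecutive blocks, `M` consecutive blocks of the
output band `[0, B']` are filled with the linear combinations, with coefficients from `G`, of
the input blocks, and the rest of the output band carries the zero function. -/
def IsSpectrumMixing {B B' : ℝ} (b : ℝ) {M : ℕ} (G : Matrix (Fin M) (Fin ⌈B / b⌉₊) ℝ)
    (Φ : BandL2 B →L[ℂ] BandL2 B') : Prop :=
  0 < b ∧ M * b ≤ B' ∧ ∀ X : BandL2 B,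
    (∀ i : Fin M, ∀ᵐ f ∂((volume : Measure ℝ).restrict (Ico 0 b)),
      (Φ X).extend ((i : ℕ) * b + f) = ∑ j, (G i j : ℂ) * X.extend ((j : ℕ) * b + f)) ∧
    (∀ᵐ f, M * b < f → (Φ X).extend f = 0)

/-! Claim 1 is soft: `L²` of any two bands of positive length are isometric by dilation, and the
hypothesis makes `B_M` positive because the logarithm is.

Claim 2 is compressed sensing, fibre by fibre. Put `b = σ / n` and `r = B_N / σ`. For an offset `f`
in `[0, b)` the samples `X (j b + f)` form a vector of length `N ≤ 2 n r`. A union of `n` intervals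
of measure at most `n b` meets at most `3 n` blocks: at most `2 n` blocks contain an end point, the
others lie inside the union, and measure allows only `n` of those (`card_blocks_le`). Hence
differences of two spectra have `6 n`-sparse fibres. A real matrix that is nearly isometric on such
vectors gives the theorem by integration over `f` (`IsSpectrumMixing.isBiLipschitzOn`).

Such a matrix with about `n log r` rows is found among the sign matrices. Exponential moments bound
the failure probability on one vector by `2 exp (-M / 12)` (`exists_signs_forall_sum_signedSum_sq`).
A union bound covers the integer points of an `ℓ¹` ball, counted by a generating function. Rounding
a suitably scaled sparse vector lands in this ball with a small, equally sparse error, so the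
estimate extends to all sparse vectors (`norm_bounds_of_int_bounds`). Expectations are written as
sums over all signs. -/

/-! ### Moments of random signed sums -/

/-- The signed sum `∑ ± v j`, with signs read off from `ε`. -/
def signedSum {N : ℕ} (v : Fin N → ℝ) (ε : Fin N → Bool) : ℝ :=
  ∑ j, (if ε j then 1 else -1) * v j

/-- Conditioning on the first sign; every moment bound below is an induction through this identity.
-/
theorem sum_signedSum_succ {N : ℕ} (F : ℝ → ℝ) (v : Fin (N + 1) → ℝ) :
    ∑ ε, F (signedSum v ε) =
      ∑ ε, (F (signedSum (fun j => v j.succ) ε + v 0) +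
        F (signedSum (fun j => v j.succ) ε - v 0)) := by
  rw [← (Fin.consEquiv (fun _ : Fin (N + 1) => Bool)).sum_comp, Fintype.sum_prod_type,
    Fintype.sum_bool, ← Finset.sum_add_distrib]
  refine Finset.sum_congr rfl fun ε _ => ?_
  simp [signedSum, Fin.sum_univ_succ, Fin.consEquiv, add_comm, sub_eq_add_neg]

theorem sum_signedSum_sq {N : ℕ} (v : Fin N → ℝ) :
    ∑ ε, signedSum v ε ^ 2 = 2 ^ N * ∑ j, v j ^ 2 := by
  induction N with
  | zero => simp [signedSum]
  | succ N ih =>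
    rw [sum_signedSum_succ (fun x => x ^ 2), Fin.sum_univ_succ]
    have h : ∀ ε, (signedSum (fun j => v j.succ) ε + v 0) ^ 2 +
        (signedSum (fun j => v j.succ) ε - v 0) ^ 2 =
        2 * signedSum (fun j => v j.succ) ε ^ 2 + 2 * v 0 ^ 2 := fun ε => by ring
    simp only [h, Finset.sum_add_distrib, ← Finset.mul_sum, ih]
    simp
    ring

theorem sum_signedSum_pow_four_le {N : ℕ} (v : Fin N → ℝ) :
    ∑ ε, signedSum v ε ^ 4 ≤ 2 ^ N * (3 * (∑ j, v j ^ 2) ^ 2) := by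
  induction N with
  | zero => simp [signedSum]
  | succ N ih =>
    rw [sum_signedSum_succ (fun x => x ^ 4), Fin.sum_univ_succ]
    have h : ∀ ε, (signedSum (fun j => v j.succ) ε + v 0) ^ 4 +
        (signedSum (fun j => v j.succ) ε - v 0) ^ 4 =
        2 * signedSum (fun j => v j.succ) ε ^ 4 +
          (12 * v 0 ^ 2) * signedSum (fun j => v j.succ) ε ^ 2 + 2 * v 0 ^ 4 := fun ε => by ring
    simp only [h, Finset.sum_add_distrib, ← Finset.mul_sum, sum_signedSum_sq]
    have := ih (fun j => v j.succ)
    simp only [Finset.sum_const, Finset.card_univ, Fintype.card_pi, Fintype.card_bool,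
      Finset.prod_const, Fintype.card_fin, nsmul_eq_mul]
    push_cast
    have h2 : (0 : ℝ) ≤ 2 ^ N * v 0 ^ 4 := by positivity
    have h3 : (2 : ℝ) ^ (N + 1) = 2 * 2 ^ N := pow_succ' _ _
    rw [h3]
    nlinarith

/-- Averaging over one sign leaves a `cosh` of the cross term. The bound `cosh y ≤ exp (y ^ 2 / 2)`
turns it into a Gaussian factor, so the form in `x` survives with a slightly larger parameter. -/
theorem exp_add_sq_add_exp_sub_sq_le (t x w : ℝ) :
    Real.exp (t * (x + w) ^ 2) + Real.exp (t * (x - w) ^ 2) ≤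
      2 * Real.exp (t * w ^ 2) * Real.exp ((t * (1 + 2 * t * w ^ 2)) * x ^ 2) := by
  have h := Real.cosh_le_exp_half_sq (2 * t * x * w)
  have e1 : Real.exp (t * (x + w) ^ 2) + Real.exp (t * (x - w) ^ 2) =
      2 * Real.exp (t * x ^ 2 + t * w ^ 2) * Real.cosh (2 * t * x * w) := by
    rw [Real.cosh_eq, show t * (x + w) ^ 2 = (t * x ^ 2 + t * w ^ 2) + 2 * t * x * w by ring,
      show t * (x - w) ^ 2 = (t * x ^ 2 + t * w ^ 2) + -(2 * t * x * w) by ring,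
      Real.exp_add _ (2 * t * x * w), Real.exp_add _ (-(2 * t * x * w))]
    ring
  rw [e1]
  calc _ ≤ 2 * Real.exp (t * x ^ 2 + t * w ^ 2) * Real.exp ((2 * t * x * w) ^ 2 / 2) := by gcongr
    _ = _ := by
      rw [mul_assoc, mul_assoc 2 (Real.exp (t * w ^ 2)), ← Real.exp_add, ← Real.exp_add]
      ring_nf

/-- A signed sum is subgaussian. -/
theorem sum_exp_signedSum_sq_le {N : ℕ} (v : Fin N → ℝ) (t : ℝ) (ht : 0 ≤ t)
    (h : 4 * t * ∑ j, v j ^ 2 ≤ 1) :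
    ∑ ε, Real.exp (t * signedSum v ε ^ 2) ≤ 2 ^ N * Real.exp (2 * t * ∑ j, v j ^ 2) := by
  induction N generalizing t with
  | zero => simp [signedSum]
  | succ N ih =>
    rw [sum_signedSum_succ (fun x => Real.exp (t * x ^ 2)), Fin.sum_univ_succ]
    rw [Fin.sum_univ_succ] at h
    set s := ∑ j : Fin N, v j.succ ^ 2 with hs
    have hs0 : 0 ≤ s := Finset.sum_nonneg fun _ _ => sq_nonneg _
    set w := v 0
    have hts : 0 ≤ t * s := by positivity
    have htw : 0 ≤ t * w ^ 2 := by positivity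
    -- Since `4 t s ≤ 1`, the extra term `8 t² w² s` is at most `2 t w²`, so the enlarged parameter
    -- is still admissible. The same inequality closes the last estimate.
    have h1 : 4 * (t * (1 + 2 * t * w ^ 2)) * s ≤ 1 := by nlinarith
    calc _ ≤ ∑ ε, 2 * Real.exp (t * w ^ 2) *
            Real.exp ((t * (1 + 2 * t * w ^ 2)) * signedSum (fun j => v j.succ) ε ^ 2) :=
          Finset.sum_le_sum fun ε _ => exp_add_sq_add_exp_sub_sq_le _ _ _
      _ ≤ 2 * Real.exp (t * w ^ 2) * (2 ^ N * Real.exp (2 * (t * (1 + 2 * t * w ^ 2)) * s)) := by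
          rw [← Finset.mul_sum]
          gcongr
          exact ih _ _ (by positivity) h1
      _ = 2 ^ (N + 1) * Real.exp (t * w ^ 2 + 2 * (t * (1 + 2 * t * w ^ 2)) * s) := by
          rw [Real.exp_add]; ring
      _ ≤ _ := by
          gcongr
          nlinarith

/-- The right side times `1 + y + y² / 2 ≤ exp y` equals `1 + y⁴ / 4 ≥ 1`. -/
theorem exp_neg_le_quadratic {y : ℝ} (hy : 0 ≤ y) : Real.exp (-y) ≤ 1 - y + y ^ 2 / 2 := by
  have h1 : 1 + y + y ^ 2 / 2 ≤ Real.exp y := Real.quadratic_le_exp_of_nonneg hy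
  have h2 : 0 < Real.exp (-y) := Real.exp_pos _
  have h3 : Real.exp (-y) * Real.exp y = 1 := by rw [← Real.exp_add]; simp
  have h4 : Real.exp (-y) * (1 + y + y ^ 2 / 2) ≤ 1 := by
    exact (mul_le_mul_of_nonneg_left h1 h2.le).trans_eq h3
  have h5 : 1 ≤ (1 - y + y ^ 2 / 2) * (1 + y + y ^ 2 / 2) := by nlinarith [sq_nonneg (y ^ 2)]
  have h6 : 0 < 1 + y + y ^ 2 / 2 := by positivity
  exact le_of_mul_le_mul_right (h4.trans h5) h6

/-- Second and fourth moments suffice for the lower tail. With `y = λ S² / s` the mean of `1 - y +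
y² / 2` is at most `1 - λ + 3 λ² / 2`; the choice `λ = 1 / 3` is optimal and gives `5 / 6`. -/
theorem sum_exp_neg_signedSum_sq_le {N : ℕ} (v : Fin N → ℝ) (hv : 0 < ∑ j, v j ^ 2) :
    ∑ ε, Real.exp (-(signedSum v ε ^ 2 / (3 * ∑ j, v j ^ 2))) ≤ 2 ^ N * Real.exp (-(1 / 6)) := by
  set s := ∑ j, v j ^ 2 with hs
  calc _ ≤ ∑ ε, (1 - signedSum v ε ^ 2 / (3 * s) + (signedSum v ε ^ 2 / (3 * s)) ^ 2 / 2) :=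
        Finset.sum_le_sum fun ε _ => exp_neg_le_quadratic (by positivity)
    _ = ∑ ε, (1 - (1 / (3 * s)) * signedSum v ε ^ 2 + (1 / (18 * s ^ 2)) * signedSum v ε ^ 4) :=
        Finset.sum_congr rfl fun ε _ => by field_simp; ring
    _ = 2 ^ N - (1 / (3 * s)) * (2 ^ N * s) + (1 / (18 * s ^ 2)) * ∑ ε, signedSum v ε ^ 4 := by
        rw [Finset.sum_add_distrib, Finset.sum_sub_distrib, ← Finset.mul_sum, ← Finset.mul_sum,
          sum_signedSum_sq]
        simp [← hs]
    _ ≤ 2 ^ N - (1 / (3 * s)) * (2 ^ N * s) + (1 / (18 * s ^ 2)) * (2 ^ N * (3 * s ^ 2)) := by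
        gcongr
        exact sum_signedSum_pow_four_le v
    _ = 2 ^ N * (-(1 / 6) + 1) := by field_simp; ring
    _ ≤ _ := by
        gcongr
        exact Real.add_one_le_exp _

/-- Independence of the rows. -/
theorem sum_exp_sum_signedSum {N M : ℕ} (v : Fin N → ℝ) (t : ℝ) :
    ∑ ε : Fin M → Fin N → Bool, Real.exp (t * ∑ i, signedSum v (ε i) ^ 2) =
      (∑ ε, Real.exp (t * signedSum v ε ^ 2)) ^ M := by
  rw [Fintype.sum_pow]
  refine Finset.sum_congr rfl fun ε _ => ?_
  rw [Finset.mul_sum, Real.exp_sum]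

/-- A sign matrix that is, up to scale, almost isometric on finitely many given vectors. -/
theorem exists_signs_forall_sum_signedSum_sq {ι : Type*} {N M : ℕ} (Z : Finset ι)
    (u : ι → Fin N → ℝ) (hu : ∀ z ∈ Z, 0 < ∑ j, u z j ^ 2)
    (hZ : (Z.card : ℝ) * (2 * Real.exp (-(M / 12 : ℝ))) < 1) :
    ∃ ε : Fin M → Fin N → Bool, ∀ z ∈ Z,
      M * (∑ j, u z j ^ 2) / 4 ≤ ∑ i, signedSum (u z) (ε i) ^ 2 ∧
      ∑ i, signedSum (u z) (ε i) ^ 2 ≤ 4 * M * ∑ j, u z j ^ 2 := by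
  let s : ι → ℝ := fun z => ∑ j, u z j ^ 2
  let Q : (Fin M → Fin N → Bool) → ι → ℝ := fun ε z => ∑ i, signedSum (u z) (ε i) ^ 2
  -- Chernoff weight for both tails: each summand is at least `1` when the corresponding bound
  -- fails, so `W < 1` forces both. The two means are at most `exp (-M / 2)` and `exp (-M / 12)`.
  let W : (Fin M → Fin N → Bool) → ι → ℝ := fun ε z =>
    Real.exp (-M) * Real.exp (1 / (4 * s z) * Q ε z) +
      Real.exp (M / 12) * Real.exp (-(1 / (3 * s z)) * Q ε z)
  have hW : ∀ z ∈ Z, ∑ ε, W ε z ≤ (2 ^ N) ^ M * (2 * Real.exp (-(M / 12 : ℝ))) := by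
    intro z hz
    have hs : 0 < s z := hu z hz
    have h1 : ∑ ε, Real.exp (1 / (4 * s z) * signedSum (u z) ε ^ 2) ≤
        2 ^ N * Real.exp (1 / 2) := by
      refine (sum_exp_signedSum_sq_le (u z) (1 / (4 * s z)) (by positivity) ?_).trans_eq ?_
      · change 4 * (1 / (4 * s z)) * s z ≤ 1
        field_simp; rfl
      · change 2 ^ N * Real.exp (2 * (1 / (4 * s z)) * s z) = _
        congr 2
        field_simp; norm_num
    have h2 : ∑ ε, Real.exp (-(1 / (3 * s z)) * signedSum (u z) ε ^ 2) ≤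
        2 ^ N * Real.exp (-(1 / 6)) := by
      refine le_trans (le_of_eq ?_) (sum_exp_neg_signedSum_sq_le (u z) hs)
      refine Finset.sum_congr rfl fun ε _ => ?_
      congr 1
      change _ = -(_ / (3 * s z))
      ring
    have e1 : Real.exp (-M) * (2 ^ N * Real.exp (1 / 2)) ^ M =
        (2 ^ N) ^ M * Real.exp (-(M / 2 : ℝ)) := by
      rw [mul_pow, ← Real.exp_nat_mul, mul_left_comm, ← Real.exp_add]
      ring_nf
    have e2 : Real.exp (M / 12) * (2 ^ N * Real.exp (-(1 / 6))) ^ M =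
        (2 ^ N) ^ M * Real.exp (-(M / 12 : ℝ)) := by
      rw [mul_pow, ← Real.exp_nat_mul, mul_left_comm, ← Real.exp_add]
      ring_nf
    have e3 : Real.exp (-(M / 2 : ℝ)) ≤ Real.exp (-(M / 12 : ℝ)) := by
      gcongr
      · norm_num
    calc ∑ ε, W ε z = Real.exp (-M) * (∑ ε, Real.exp (1 / (4 * s z) * signedSum (u z) ε ^ 2)) ^ M
          + Real.exp (M / 12) *
            (∑ ε, Real.exp (-(1 / (3 * s z)) * signedSum (u z) ε ^ 2)) ^ M := by
          simp only [← sum_exp_sum_signedSum, W, Q, Finset.sum_add_distrib, ← Finset.mul_sum]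
      _ ≤ Real.exp (-M) * (2 ^ N * Real.exp (1 / 2)) ^ M
          + Real.exp (M / 12) * (2 ^ N * Real.exp (-(1 / 6))) ^ M := by gcongr
      _ ≤ _ := by
          rw [e1, e2, ← mul_add, two_mul]
          gcongr
  have hlt : ∑ ε, ∑ z ∈ Z, W ε z < ∑ _ε : Fin M → Fin N → Bool, (1 : ℝ) := by
    rw [Finset.sum_comm]
    calc _ ≤ ∑ z ∈ Z, (2 ^ N : ℝ) ^ M * (2 * Real.exp (-(M / 12 : ℝ))) := Finset.sum_le_sum hW
      _ = (2 ^ N : ℝ) ^ M * (Z.card * (2 * Real.exp (-(M / 12 : ℝ)))) := by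
        rw [Finset.sum_const, nsmul_eq_mul]; ring
      _ < (2 ^ N : ℝ) ^ M * 1 := by gcongr
      _ = _ := by simp
  obtain ⟨ε, -, hε⟩ := Finset.exists_lt_of_sum_lt hlt
  refine ⟨ε, fun z hz => ?_⟩
  have hs : 0 < s z := hu z hz
  have hWz : W ε z < 1 := (Finset.single_le_sum (f := W ε)
    (fun i _ => by positivity) hz).trans_lt hε
  change M * s z / 4 ≤ Q ε z ∧ Q ε z ≤ 4 * M * s z
  have p1 := mul_pos (Real.exp_pos (-M)) (Real.exp_pos (1 / (4 * s z) * Q ε z))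
  have p2 := mul_pos (Real.exp_pos (M / 12)) (Real.exp_pos (-(1 / (3 * s z)) * Q ε z))
  have q1 : Real.exp (-M + 1 / (4 * s z) * Q ε z) < 1 := by
    rw [Real.exp_add]; linarith
  have q2 : Real.exp (M / 12 + -(1 / (3 * s z)) * Q ε z) < 1 := by
    rw [Real.exp_add]; linarith
  rw [Real.exp_lt_one_iff] at q1 q2
  have r1 : 1 / (4 * s z) * Q ε z * (4 * s z) = Q ε z := by field_simp
  have r2 : 1 / (3 * s z) * Q ε z * (3 * s z) = Q ε z := by field_simp
  constructor <;> nlinarith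

/-! ### Counting integer points of an `ℓ¹` ball -/

theorem sum_Icc_pow_natAbs_le {l : ℝ} (h0 : 0 ≤ l) (h1 : l ≤ 1 / 2) (m : ℕ) :
    ∑ x ∈ Finset.Icc (-(m : ℤ)) m, l ^ x.natAbs ≤ 1 + 4 * l := by
  have hsub : Finset.Icc (-(m : ℤ)) m ⊆
      (Finset.range (m + 1)).image (fun k : ℕ => (k : ℤ)) ∪
        (Finset.range m).image (fun k : ℕ => -((k : ℤ) + 1)) := by
    intro x hx
    simp only [Finset.mem_Icc] at hx
    simp only [Finset.mem_union, Finset.mem_image, Finset.mem_range]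
    rcases le_or_gt 0 x with h | h
    · exact Or.inl ⟨x.toNat, by omega, by omega⟩
    · exact Or.inr ⟨(-x - 1).toNat, by omega, by omega⟩
  have hg : ∀ k, ∑ i ∈ Finset.range k, l ^ i ≤ 2 := by
    intro k
    have : (∑ i ∈ Finset.range k, l ^ i) * (1 - l) = 1 - l ^ k := geom_sum_mul_neg l k
    have h2 : 0 ≤ l ^ k := by positivity
    have h3 : 0 ≤ ∑ i ∈ Finset.range k, l ^ i := Finset.sum_nonneg fun _ _ => by positivity
    nlinarith
  calc _ ≤ _ := Finset.sum_le_sum_of_subset_of_nonneg hsub fun _ _ _ => by positivity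
    _ = (∑ i ∈ Finset.range m, l ^ i * l + 1) + ∑ i ∈ Finset.range m, l ^ i * l := by
        rw [Finset.sum_union, Finset.sum_image (by intro; simp), Finset.sum_image (by intro; simp),
          Finset.sum_range_succ']
        · congr 1
        · rw [Finset.disjoint_left]
          simp only [Finset.mem_image, not_exists, not_and]
          rintro _ ⟨a, -, rfl⟩ b -
          omega
    _ ≤ 1 + 4 * l := by
        rw [← Finset.sum_mul]
        nlinarith [hg m]

/-- The integer points of the `ℓ¹` ball of radius `m`. -/
noncomputable def intL1Ball (N m : ℕ) : Finset (Fin N → ℤ) :=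
  (Fintype.piFinset fun _ => Finset.Icc (-(m : ℤ)) m).filter fun z => ∑ j, (z j).natAbs ≤ m

theorem mem_intL1Ball {N m : ℕ} {z : Fin N → ℤ} :
    z ∈ intL1Ball N m ↔ ∑ j, (z j).natAbs ≤ m := by
  simp only [intL1Ball, Finset.mem_filter, Fintype.mem_piFinset, Finset.mem_Icc,
    and_iff_right_iff_imp]
  intro h j
  have : (z j).natAbs ≤ ∑ j, (z j).natAbs :=
    Finset.single_le_sum (f := fun j => (z j).natAbs) (fun _ _ => Nat.zero_le _) (Finset.mem_univ j)
  omega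

/-- Give `z` the weight `l ^ ‖z‖₁`. Each point of the ball weighs at least `l ^ m`, while the total
weight over the surrounding cube factors over the coordinates. -/
theorem card_intL1Ball_mul_pow_le {l : ℝ} (h0 : 0 ≤ l) (h1 : l ≤ 1 / 2) (N m : ℕ) :
    ((intL1Ball N m).card : ℝ) * l ^ m ≤ Real.exp (4 * l * N) := by
  calc ((intL1Ball N m).card : ℝ) * l ^ m = ∑ z ∈ intL1Ball N m, l ^ m := by
        rw [Finset.sum_const, nsmul_eq_mul]
    _ ≤ ∑ z ∈ intL1Ball N m, ∏ j, l ^ (z j).natAbs := by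
        refine Finset.sum_le_sum fun z hz => ?_
        rw [Finset.prod_pow_eq_pow_sum]
        exact pow_le_pow_of_le_one h0 (by linarith) (mem_intL1Ball.1 hz)
    _ ≤ ∑ z ∈ Fintype.piFinset fun _ : Fin N => Finset.Icc (-(m : ℤ)) m,
          ∏ j, l ^ (z j).natAbs :=
        Finset.sum_le_sum_of_subset_of_nonneg (Finset.filter_subset _ _) fun _ _ _ => by positivity
    _ = (∑ x ∈ Finset.Icc (-(m : ℤ)) m, l ^ x.natAbs) ^ N := by
        rw [Finset.sum_prod_piFinset (Finset.Icc (-(m : ℤ)) m) (fun _ x => l ^ x.natAbs)]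
        simp
    _ ≤ (Real.exp (4 * l)) ^ N := by
        refine pow_le_pow_left₀ (Finset.sum_nonneg fun _ _ => by positivity) ?_ N
        · refine (sum_Icc_pow_natAbs_le h0 h1 m).trans ?_
          linarith [Real.add_one_le_exp (4 * l)]
    _ = _ := by rw [← Real.exp_nat_mul]; ring_nf

/-- Twice the number of integer points of the `ℓ¹` ball of radius `48 n` in dimension at most
`2 n r` is exponential in `n * log r`. -/
theorem two_mul_card_intL1Ball_lt {n N M : ℕ} {r : ℝ} (hn : 1 ≤ n) (hr : 2 ≤ r)
    (hN : (N : ℝ) ≤ 2 * n * r) (hM : 1300 * n * Real.log r ≤ M) :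
    ((intL1Ball N (48 * n)).card : ℝ) * (2 * Real.exp (-(M / 12 : ℝ))) < 1 := by
  have hr0 : 0 < r := by linarith
  have hn1 : (1 : ℝ) ≤ n := by exact_mod_cast hn
  have hlog2 := Real.log_two_gt_d9
  have hlog2' := Real.log_two_lt_d9
  have hlr : Real.log 2 ≤ Real.log r := Real.log_le_log (by norm_num) hr
  have hnl : (n : ℝ) * Real.log 2 ≤ n * Real.log r := by gcongr
  -- With `l = 1 / (2 r)` the exponent `4 l N` is at most `4 n`, and `l ^ (-48 n)` costs only `48 n
  -- log (2 r)`.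
  have key := card_intL1Ball_mul_pow_le (l := (2 * r)⁻¹) (by positivity)
    (by rw [inv_le_comm₀ (by positivity) (by norm_num)]; linarith) N (48 * n)
  have h1 : 4 * (2 * r)⁻¹ * N ≤ 4 * n := by
    rw [mul_assoc]
    gcongr
    rw [inv_mul_le_iff₀ (by positivity)]
    linarith
  have h2 : ((2 * r)⁻¹ : ℝ) ^ (48 * n) = Real.exp (-(48 * n * (Real.log 2 + Real.log r))) := by
    rw [← Real.log_mul (by norm_num) hr0.ne', Real.exp_neg, inv_pow, mul_comm (48 * (n : ℝ)),
      Real.exp_mul, Real.exp_log (by positivity)]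
    rw [← Real.rpow_natCast]; push_cast; rfl
  have h3 : ((intL1Ball N (48 * n)).card : ℝ) ≤
      Real.exp (4 * n + 48 * n * (Real.log 2 + Real.log r)) := by
    rw [Real.exp_add]
    rw [h2, Real.exp_neg] at key
    rw [mul_inv_le_iff₀ (Real.exp_pos _)] at key
    refine key.trans ?_
    gcongr
  have h4 : (2 : ℝ) = Real.exp (Real.log 2) := (Real.exp_log (by norm_num)).symm
  calc _ ≤ Real.exp (4 * n + 48 * n * (Real.log 2 + Real.log r)) *
        (Real.exp (Real.log 2) * Real.exp (-(M / 12 : ℝ))) := by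
        rw [← h4]; gcongr
    _ = Real.exp (4 * n + 48 * n * (Real.log 2 + Real.log r) + (Real.log 2 + -(M / 12 : ℝ))) := by
        rw [← Real.exp_add, ← Real.exp_add]
    -- As `log 2 ≤ log r`, the positive terms are below `103 n log r`, while `M / 12` exceeds `108 n
    -- log r`.
    _ < 1 := by
        rw [Real.exp_lt_one_iff]
        nlinarith

/-! ### From integer points to sparse vectors -/

/-- Coordinatewise rounding keeps zeros, so the error is supported where `w` is. A nonzero rounded
value at most doubles the coordinate, and Cauchy–Schwarz gives `‖w‖₁ ≤ 4 k`. The error is one eighth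
of `‖w‖`. -/
theorem exists_int_approx {N k : ℕ} (w : EuclideanSpace ℝ (Fin N))
    (hw : (Finset.univ.filter fun j => w j ≠ 0).card ≤ k) (hn : ‖w‖ = 4 * √k) :
    ∃ z : Fin N → ℤ, ∑ j, (z j).natAbs ≤ 8 * k ∧
      (Finset.univ.filter fun j => (w - WithLp.toLp 2 fun j => (z j : ℝ)) j ≠ 0).card ≤ k ∧
      ‖w - WithLp.toLp 2 fun j => (z j : ℝ)‖ ≤ √k / 2 := by
  set T := Finset.univ.filter fun j => w j ≠ 0 with hT
  have hTw : ∀ j ∉ T, w j = 0 := by simp [hT]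
  have hkT : (T.card : ℝ) ≤ k := by exact_mod_cast hw
  refine ⟨fun j => round (w j), ?_, ?_, ?_⟩
  · have h1 : ∀ j, ((round (w j)).natAbs : ℝ) ≤ 2 * |w j| := by
      intro j
      rw [Nat.cast_natAbs, Int.cast_abs]
      have h := abs_sub_round (w j)
      have h3 : |(round (w j) : ℝ)| ≤ |w j| + 1 / 2 := by
        have := abs_sub_abs_le_abs_sub (round (w j) : ℝ) (w j)
        rw [abs_sub_comm] at this
        linarith
      by_cases h0 : round (w j) = 0
      · simp [h0]
      · have : (1 : ℝ) ≤ |(round (w j) : ℝ)| := by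
          exact_mod_cast Int.one_le_abs h0
        linarith
    have h2 : (∑ j ∈ T, |w j|) ^ 2 ≤ T.card * ∑ j ∈ T, |w j| ^ 2 := sq_sum_le_card_mul_sum_sq
    have h3 : ∑ j ∈ T, |w j| ^ 2 = 16 * k := by
      have : ∑ j ∈ T, |w j| ^ 2 = ‖w‖ ^ 2 := by
        rw [EuclideanSpace.norm_sq_eq]
        refine Finset.sum_subset (Finset.subset_univ _) fun j _ hj => ?_
        simp [hTw j hj]
      rw [this, hn, mul_pow, Real.sq_sqrt (by positivity)]
      norm_num
    have h4 : ∑ j ∈ T, |w j| ≤ 4 * k := by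
      rw [h3] at h2
      have h5 : (0 : ℝ) ≤ k := by positivity
      refine abs_le_of_sq_le_sq' ?_ (by positivity) |>.2
      nlinarith
    have h5 : ∑ j, |w j| = ∑ j ∈ T, |w j| := by
      symm
      refine Finset.sum_subset (Finset.subset_univ _) fun j _ hj => ?_
      simp [hTw j hj]
    have h6 : ((∑ j, (round (w j)).natAbs : ℕ) : ℝ) ≤ 8 * k := by
      push_cast
      calc _ ≤ ∑ j, 2 * |w j| := Finset.sum_le_sum fun j _ => by simpa using h1 j
        _ = 2 * ∑ j ∈ T, |w j| := by rw [← Finset.mul_sum, h5]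
        _ ≤ _ := by linarith
    exact_mod_cast h6
  · refine le_trans (Finset.card_le_card ?_) hw
    intro j
    simp only [Finset.mem_filter, Finset.mem_univ, true_and, hT]
    contrapose!
    intro h
    simp [h]
  · rw [← abs_of_nonneg (norm_nonneg (w - _))]
    refine abs_le_of_sq_le_sq ?_ (by positivity)
    rw [EuclideanSpace.norm_sq_eq, div_pow, Real.sq_sqrt (by positivity)]
    calc _ = ∑ j ∈ T, ‖(w - WithLp.toLp 2 fun j => (round (w j) : ℝ)) j‖ ^ 2 := by
          symm
          refine Finset.sum_subset (Finset.subset_univ _) fun j _ hj => ?_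
          simp [hTw j hj]
      _ ≤ ∑ j ∈ T, (1 / 2 : ℝ) ^ 2 := by
          refine Finset.sum_le_sum fun j _ => ?_
          gcongr
          simpa using abs_sub_round (w j)
      _ = T.card / 4 := by rw [Finset.sum_const, nsmul_eq_mul]; ring
      _ ≤ _ := by norm_num; linarith

/-- A linear map that is almost isometric on the integer points of an `ℓ¹` ball is almost
isometric on the sparse vectors. -/
theorem norm_bounds_of_int_bounds {N k : ℕ} (hk : 1 ≤ k) {F : Type*} [NormedAddCommGroup F]
    [NormedSpace ℝ F] (L : EuclideanSpace ℝ (Fin N) →L[ℝ] F) {A : ℝ} (hA : 0 ≤ A)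
    (hL : ∀ z : Fin N → ℤ, ∑ j, (z j).natAbs ≤ 8 * k →
      A / 2 * ‖(WithLp.toLp 2 fun j => (z j : ℝ) : EuclideanSpace ℝ (Fin N))‖ ≤
        ‖L (WithLp.toLp 2 fun j => (z j : ℝ))‖ ∧
      ‖L (WithLp.toLp 2 fun j => (z j : ℝ))‖ ≤
        2 * A * ‖(WithLp.toLp 2 fun j => (z j : ℝ) : EuclideanSpace ℝ (Fin N))‖)
    (v : EuclideanSpace ℝ (Fin N)) (hv : (Finset.univ.filter fun j => v j ≠ 0).card ≤ k) :
    A / 10 * ‖v‖ ≤ ‖L v‖ ∧ ‖L v‖ ≤ 3 * A * ‖v‖ := by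
  have hk0 : 0 < √(k : ℝ) := Real.sqrt_pos.2 (by exact_mod_cast hk)
  -- reduction to vectors of norm `4 √k`
  have scale : ∀ v : EuclideanSpace ℝ (Fin N), v ≠ 0 →
      (Finset.univ.filter fun j => v j ≠ 0).card ≤ k → ∃ (t : ℝ) (w : EuclideanSpace ℝ (Fin N)),
      0 < t ∧ v = t • w ∧ ‖w‖ = 4 * √k ∧ (Finset.univ.filter fun j => w j ≠ 0).card ≤ k := by
    intro v h0 hv
    have hn : 0 < ‖v‖ := norm_pos_iff.2 h0
    refine ⟨‖v‖ / (4 * √k), (4 * √k / ‖v‖) • v, by positivity, ?_, ?_, ?_⟩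
    · rw [smul_smul, div_mul_div_cancel₀ (by positivity), div_self hn.ne', one_smul]
    · rw [norm_smul, Real.norm_of_nonneg (by positivity), div_mul_cancel₀ _ hn.ne']
    · refine le_trans (Finset.card_le_card fun j => ?_) hv
      simp only [Finset.mem_filter, Finset.mem_univ, true_and]
      contrapose!
      intro h
      simp [h]
  -- Bootstrap: an upper constant `C` for sparse vectors improves to `9 / 4 * A + C / 8`, since the
  -- rounding error is itself sparse. Iterating from the operator norm converges to the fixed point
  -- `18 / 7 * A`.
  have step : ∀ C : ℝ, 0 ≤ C → (∀ v : EuclideanSpace ℝ (Fin N),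
      (Finset.univ.filter fun j => v j ≠ 0).card ≤ k → ‖L v‖ ≤ C * ‖v‖) →
      ∀ v : EuclideanSpace ℝ (Fin N),
      (Finset.univ.filter fun j => v j ≠ 0).card ≤ k → ‖L v‖ ≤ (9 / 4 * A + C / 8) * ‖v‖ := by
    intro C hC h v hv
    by_cases h0 : v = 0
    · simp [h0]
    obtain ⟨t, w, ht, rfl, hw, hws⟩ := scale v h0 hv
    obtain ⟨z, hz1, hz2, hz3⟩ := exists_int_approx w hws hw
    set y : EuclideanSpace ℝ (Fin N) := WithLp.toLp 2 fun j => (z j : ℝ) with hy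
    have h1 := (hL z hz1).2
    have h2 := h _ hz2
    have h3 : ‖L w‖ ≤ ‖L y‖ + ‖L (w - y)‖ := by
      have := norm_add_le (L y) (L (w - y))
      rwa [← map_add, add_sub_cancel] at this
    have h4 : ‖y‖ ≤ ‖w‖ + ‖w - y‖ := norm_le_norm_add_norm_sub' y w |>.trans_eq (by rw [norm_sub_rev])
    rw [map_smul, norm_smul, norm_smul, Real.norm_of_nonneg ht.le, mul_left_comm]
    gcongr
    have h5 : C * ‖w - y‖ ≤ C * (√k / 2) := by gcongr
    have h6 : 2 * A * ‖y‖ ≤ 2 * A * (4 * √k + √k / 2) := by gcongr; linarith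
    rw [hw]
    linarith
  have iter : ∀ m : ℕ, ∀ v : EuclideanSpace ℝ (Fin N),
      (Finset.univ.filter fun j => v j ≠ 0).card ≤ k →
      ‖L v‖ ≤ (18 / 7 * A + ‖L‖ * (1 / 8) ^ m) * ‖v‖ := by
    intro m
    induction m with
    | zero =>
      intro v _
      refine (L.le_opNorm v).trans ?_
      gcongr
      simp only [pow_zero, mul_one, le_add_iff_nonneg_left]
      positivity
    | succ m ih =>
      intro v hv
      refine (step _ (by positivity) ih v hv).trans_eq ?_
      rw [pow_succ]; ring
  have upper : ∀ v : EuclideanSpace ℝ (Fin N),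
      (Finset.univ.filter fun j => v j ≠ 0).card ≤ k → ‖L v‖ ≤ 18 / 7 * A * ‖v‖ := by
    intro v hv
    refine ge_of_tendsto' (f := fun m : ℕ => (18 / 7 * A + ‖L‖ * (1 / 8) ^ m) * ‖v‖)
      (x := Filter.atTop) ?_ fun m => iter m v hv
    have : Filter.Tendsto (fun m : ℕ => (1 / 8 : ℝ) ^ m) Filter.atTop (nhds 0) :=
      tendsto_pow_atTop_nhds_zero_of_lt_one (by norm_num) (by norm_num)
    simpa using ((this.const_mul ‖L‖).const_add (18 / 7 * A)).mul_const ‖v‖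
  refine ⟨?_, (upper v hv).trans (by gcongr; norm_num)⟩
  by_cases h0 : v = 0
  · simp [h0]
  obtain ⟨t, w, ht, rfl, hw, hws⟩ := scale v h0 hv
  obtain ⟨z, hz1, hz2, hz3⟩ := exists_int_approx w hws hw
  set y : EuclideanSpace ℝ (Fin N) := WithLp.toLp 2 fun j => (z j : ℝ) with hy
  have h1 := (hL z hz1).1
  have h2 := upper _ hz2
  have h3 : ‖L y‖ ≤ ‖L w‖ + ‖L (w - y)‖ := by
    have := norm_sub_le (L w) (L (w - y))
    rwa [← map_sub, sub_sub_cancel] at this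
  have h4 : ‖w‖ ≤ ‖y‖ + ‖w - y‖ := norm_le_norm_add_norm_sub' w y
  rw [map_smul, norm_smul, norm_smul, Real.norm_of_nonneg ht.le, mul_left_comm]
  gcongr
  -- In units of `A √k`: the integer point contributes `7 / 4`, the error costs `9 / 7`, and `13 /
  -- 28` remains, above the required `4 / 10`.
  have h5 : 18 / 7 * A * ‖w - y‖ ≤ 18 / 7 * A * (√k / 2) := by gcongr
  have h6 : A / 2 * (4 * √k - √k / 2) ≤ A / 2 * ‖y‖ := by gcongr; linarith
  rw [hw]
  have h7 : 0 ≤ A * √k := by positivity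
  linarith

/-- Real matrices with the restricted isometry property for `6 n`-sparse complex vectors. -/
theorem exists_matrix_restricted_isometry {n N M : ℕ} {r : ℝ} (hn : 1 ≤ n) (hr : 2 ≤ r)
    (hN : (N : ℝ) ≤ 2 * n * r) (hM : 1300 * n * Real.log r ≤ M) :
    ∃ G : Matrix (Fin M) (Fin N) ℝ, ∀ v : Fin N → ℂ,
      (Finset.univ.filter fun j => v j ≠ 0).card ≤ 6 * n →
      1 / 100 * ∑ j, ‖v j‖ ^ 2 ≤ ∑ i, ‖∑ j, (G i j : ℂ) * v j‖ ^ 2 ∧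
      ∑ i, ‖∑ j, (G i j : ℂ) * v j‖ ^ 2 ≤ 9 * ∑ j, ‖v j‖ ^ 2 := by
  have hM0 : (0 : ℝ) < M := lt_of_lt_of_le
    (mul_pos (by positivity) (Real.log_pos (by linarith))) hM
  obtain ⟨ε, hε⟩ := exists_signs_forall_sum_signedSum_sq (M := M)
    -- The radius is `8 k` with `k = 6 n`; the zero vector is removed because the tail bounds divide
    -- by the squared norm.
    ((intL1Ball N (48 * n)).filter fun z => z ≠ 0) (fun z j => (z j : ℝ)) (by
      intro z hz
      obtain ⟨j, hj⟩ := Function.ne_iff.1 (Finset.mem_filter.1 hz).2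
      refine Finset.sum_pos' (fun _ _ => sq_nonneg _) ⟨j, Finset.mem_univ _, ?_⟩
      have : (z j : ℝ) ≠ 0 := by exact_mod_cast hj
      positivity) (by
      refine lt_of_le_of_lt ?_ (two_mul_card_intL1Ball_lt hn hr hN hM)
      gcongr
      exact Finset.filter_subset _ _)
  let S : Matrix (Fin M) (Fin N) ℝ := fun i j => if ε i j then 1 else -1
  let L : EuclideanSpace ℝ (Fin N) →L[ℝ] EuclideanSpace ℝ (Fin M) :=
    (Matrix.toEuclideanLin S).toContinuousLinearMap
  have hLi : ∀ v i, L v i = ∑ j, S i j * v j := fun v i => rfl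
  have hLn : ∀ v, ‖L v‖ ^ 2 = ∑ i, (∑ j, S i j * v j) ^ 2 := by
    intro v
    rw [EuclideanSpace.real_norm_sq_eq]
    simp only [hLi]
  have hsq : ∀ (v : EuclideanSpace ℝ (Fin N)),
      (Finset.univ.filter fun j => v j ≠ 0).card ≤ 6 * n →
      √M / 10 * ‖v‖ ≤ ‖L v‖ ∧ ‖L v‖ ≤ 3 * √M * ‖v‖ := by
    refine norm_bounds_of_int_bounds (by omega) L (Real.sqrt_nonneg _) fun z hz => ?_
    by_cases hz0 : z = 0
    · subst hz0
      have : (WithLp.toLp 2 fun j => (((0 : Fin N → ℤ) j : ℤ) : ℝ) : EuclideanSpace ℝ (Fin N)) = 0 := by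
        ext; simp
      rw [this]; simp
    have hzm := hε z (Finset.mem_filter.2 ⟨mem_intL1Ball.2 (by omega), hz0⟩)
    set y : EuclideanSpace ℝ (Fin N) := WithLp.toLp 2 fun j => (z j : ℝ) with hy
    have e1 : ∑ i, signedSum (fun j => (z j : ℝ)) (ε i) ^ 2 = ‖L y‖ ^ 2 := (hLn y).symm
    have e2 : ∑ j, (z j : ℝ) ^ 2 = ‖y‖ ^ 2 := (EuclideanSpace.real_norm_sq_eq y).symm
    rw [e1, e2] at hzm
    have e3 : √(M : ℝ) ^ 2 = M := Real.sq_sqrt hM0.le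
    constructor
    · refine abs_le_of_sq_le_sq' ?_ (norm_nonneg _) |>.2
      rw [mul_pow, div_pow, e3]
      linarith [hzm.1]
    · refine abs_le_of_sq_le_sq' ?_ (by positivity) |>.2
      rw [mul_pow, mul_pow, e3]
      linarith [hzm.2]
  have hreal : ∀ v : Fin N → ℝ, (Finset.univ.filter fun j => v j ≠ 0).card ≤ 6 * n →
      1 / 100 * ∑ j, v j ^ 2 ≤ ∑ i, (∑ j, (√M)⁻¹ * S i j * v j) ^ 2 ∧
      ∑ i, (∑ j, (√M)⁻¹ * S i j * v j) ^ 2 ≤ 9 * ∑ j, v j ^ 2 := by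
    intro v hv
    obtain ⟨h1, h2⟩ := hsq (WithLp.toLp 2 v) hv
    have e3 : √(M : ℝ) ^ 2 = M := Real.sq_sqrt hM0.le
    have e1 : ∑ i, (∑ j, (√M)⁻¹ * S i j * v j) ^ 2 = (M : ℝ)⁻¹ * ‖L (WithLp.toLp 2 v)‖ ^ 2 := by
      rw [hLn, Finset.mul_sum]
      refine Finset.sum_congr rfl fun i _ => ?_
      simp only [mul_assoc, ← Finset.mul_sum]
      rw [mul_pow, inv_pow, e3]
    have e2 : ∑ j, v j ^ 2 = ‖(WithLp.toLp 2 v : EuclideanSpace ℝ (Fin N))‖ ^ 2 :=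
      (EuclideanSpace.real_norm_sq_eq _).symm
    rw [e1, e2]
    have g1 := pow_le_pow_left₀ (by positivity) h1 2
    have g2 := pow_le_pow_left₀ (by positivity) h2 2
    rw [mul_pow, div_pow, e3] at g1
    rw [mul_pow, mul_pow, e3] at g2
    constructor
    · rw [le_inv_mul_iff₀ hM0]; linarith
    · rw [inv_mul_le_iff₀ hM0]; linarith
  refine ⟨fun i j => (√M)⁻¹ * S i j, fun v hv => ?_⟩
  -- A real matrix acts separately on real and imaginary parts, whose supports lie in that of `v`.
  have hnorm : ∀ z : ℂ, ‖z‖ ^ 2 = z.re ^ 2 + z.im ^ 2 := fun z => by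
    rw [Complex.sq_norm, Complex.normSq_apply]; ring
  have hre := hreal (fun j => (v j).re) (le_trans (Finset.card_le_card fun j => by
    simp only [Finset.mem_filter, Finset.mem_univ, true_and]
    contrapose!
    intro h; simp [h]) hv)
  have him := hreal (fun j => (v j).im) (le_trans (Finset.card_le_card fun j => by
    simp only [Finset.mem_filter, Finset.mem_univ, true_and]
    contrapose!
    intro h; simp [h]) hv)
  simp only [hnorm, Complex.re_sum, Complex.im_sum, Complex.re_ofReal_mul, Complex.im_ofReal_mul,
    Finset.sum_add_distrib]
  constructor <;> linarith [hre.1, hre.2, him.1, him.2]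

/-! ### Spectra as functions on the line -/

section extend

variable {B B' : ℝ}

theorem BandL2.extend_ae_eq_of_ae_eq {X : BandL2 B} {g : ℝ → ℂ}
    (h : ∀ᵐ f ∂((volume : Measure ℝ).restrict (Icc 0 B)), X f = g f)
    (hg : ∀ f ∉ Icc 0 B, g f = 0) : X.extend =ᵐ[volume] g := by
  rw [ae_restrict_iff' measurableSet_Icc] at h
  filter_upwards [h] with f hf
  by_cases hfB : f ∈ Icc 0 B
  · rw [BandL2.extend, indicator_of_mem hfB, hf hfB]
  · rw [BandL2.extend, indicator_of_notMem hfB, hg f hfB]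

theorem BandL2.extend_of_notMem (X : BandL2 B) {f : ℝ} (hf : f ∉ Icc 0 B) : X.extend f = 0 :=
  indicator_of_notMem hf _

theorem BandL2.extend_add (X Y : BandL2 B) :
    (X + Y).extend =ᵐ[volume] X.extend + Y.extend := by
  refine BandL2.extend_ae_eq_of_ae_eq ?_ fun f hf => by
    simp [X.extend_of_notMem hf, Y.extend_of_notMem hf]
  filter_upwards [Lp.coeFn_add X Y, ae_restrict_mem measurableSet_Icc] with f h1 h2
  rw [h1]
  simp [BandL2.extend, indicator_of_mem h2]

theorem BandL2.extend_sub (X Y : BandL2 B) :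
    (X - Y).extend =ᵐ[volume] X.extend - Y.extend := by
  refine BandL2.extend_ae_eq_of_ae_eq ?_ fun f hf => by
    simp [X.extend_of_notMem hf, Y.extend_of_notMem hf]
  filter_upwards [Lp.coeFn_sub X Y, ae_restrict_mem measurableSet_Icc] with f h1 h2
  rw [h1]
  simp [BandL2.extend, indicator_of_mem h2]

theorem BandL2.extend_smul (c : ℂ) (X : BandL2 B) :
    (c • X).extend =ᵐ[volume] c • X.extend := by
  refine BandL2.extend_ae_eq_of_ae_eq ?_ fun f hf => by
    simp [X.extend_of_notMem hf]
  filter_upwards [Lp.coeFn_smul c X, ae_restrict_mem measurableSet_Icc] with f h1 h2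
  simp [h1, BandL2.extend, indicator_of_mem h2]

theorem BandL2.aestronglyMeasurable_extend (X : BandL2 B) :
    AEStronglyMeasurable X.extend volume :=
  (aestronglyMeasurable_indicator_iff measurableSet_Icc).2 (Lp.aestronglyMeasurable X)

theorem eLpNorm_two_sq {α : Type*} [MeasurableSpace α] (μ : Measure α) (f : α → ℂ) :
    eLpNorm f 2 μ ^ 2 = ∫⁻ x, ‖f x‖ₑ ^ 2 ∂μ := by
  have h := eLpNorm_nnreal_pow_eq_lintegral (f := f) (μ := μ) (p := 2) (by norm_num)
  have e2 : ((2 : NNReal) : ℝ) = (2 : ℕ) := by norm_num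
  rw [e2] at h
  simp only [ENNReal.rpow_natCast] at h
  exact_mod_cast h

theorem BandL2.ofReal_norm_sq (X : BandL2 B) :
    ENNReal.ofReal (‖X‖ ^ 2) = ∫⁻ f, ‖X.extend f‖ₑ ^ 2 := by
  rw [ENNReal.ofReal_pow (norm_nonneg _), ofReal_norm, Lp.enorm_def, eLpNorm_two_sq,
    ← lintegral_indicator measurableSet_Icc]
  refine lintegral_congr fun f => ?_
  by_cases hf : f ∈ Icc 0 B <;> simp [BandL2.extend, hf]

/-- A linear map on functions that is bounded for the `L²` norm induces a bounded operator between
bands. -/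
theorem exists_bandL2_clm (T : (ℝ → ℂ) →ₗ[ℂ] (ℝ → ℂ))
    (hae : ∀ f g : ℝ → ℂ, f =ᵐ[volume] g → T f =ᵐ[volume] T g)
    (hmeas : ∀ f : ℝ → ℂ, AEStronglyMeasurable f volume → AEStronglyMeasurable (T f) volume)
    {K : ℝ} (hK0 : 0 ≤ K)
    (hK : ∀ f : ℝ → ℂ, AEStronglyMeasurable f volume →
      ∫⁻ x, ‖T f x‖ₑ ^ 2 ≤ ENNReal.ofReal K * ∫⁻ x, ‖f x‖ₑ ^ 2) :
    ∃ Φ : BandL2 B →L[ℂ] BandL2 B', ∀ X : BandL2 B,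
      ∀ᵐ f ∂((volume : Measure ℝ).restrict (Icc 0 B')), Φ X f = T X.extend f := by
  have hle : ∀ X : BandL2 B, eLpNorm (T X.extend) 2 ((volume : Measure ℝ).restrict (Icc 0 B')) ^ 2
      ≤ ENNReal.ofReal (K * ‖X‖ ^ 2) := by
    intro X
    rw [eLpNorm_two_sq, ENNReal.ofReal_mul hK0, X.ofReal_norm_sq]
    exact (setLIntegral_le_lintegral _ _).trans (hK _ X.aestronglyMeasurable_extend)
  have hmem : ∀ X : BandL2 B,
      MemLp (T X.extend) 2 ((volume : Measure ℝ).restrict (Icc 0 B')) := fun X =>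
    ⟨(hmeas _ X.aestronglyMeasurable_extend).restrict, by
      have := (hle X).trans_lt ENNReal.ofReal_lt_top
      by_contra h
      rw [not_lt_top_iff] at h
      simp [h] at this⟩
  let Φ : BandL2 B →ₗ[ℂ] BandL2 B' :=
    { toFun := fun X => (hmem X).toLp
      map_add' := fun X Y => by
        rw [← MemLp.toLp_add, MemLp.toLp_eq_toLp_iff, ← map_add]
        exact ae_restrict_of_ae (hae _ _ (X.extend_add Y))
      map_smul' := fun c X => by
        rw [RingHom.id_apply, ← MemLp.toLp_const_smul, MemLp.toLp_eq_toLp_iff, ← map_smul]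
        exact ae_restrict_of_ae (hae _ _ (X.extend_smul c)) }
  refine ⟨Φ.mkContinuous (√K) fun X => ?_, fun X => (hmem X).coeFn_toLp⟩
  refine abs_le_of_sq_le_sq' ?_ (by positivity) |>.2
  rw [mul_pow, Real.sq_sqrt hK0, ← ENNReal.ofReal_le_ofReal_iff (by positivity)]
  refine le_trans (le_of_eq ?_) (hle X)
  rw [ENNReal.ofReal_pow (norm_nonneg _), ofReal_norm]
  exact congrArg (· ^ 2) (Lp.enorm_toLp (hmem X))

end extend

/-! ### Dilation between bands -/

section dilation

theorem lintegral_comp_const_mul {k : ℝ} (hk : 0 < k) (g : ℝ → ENNReal) :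
    ENNReal.ofReal k * ∫⁻ x, g (k * x) = ∫⁻ x, g x := by
  have h1 : ∫⁻ x, g (k * x) = ∫⁻ y, g y ∂(volume.map (k * ·)) :=
    ((Homeomorph.mulLeft₀ k hk.ne').measurableEmbedding.lintegral_map g).symm
  rw [h1, Real.map_volume_mul_left hk.ne', lintegral_smul_measure, smul_eq_mul, ← mul_assoc,
    abs_of_pos (inv_pos.2 hk), ← ENNReal.ofReal_mul hk.le, mul_inv_cancel₀ hk.ne',
    ENNReal.ofReal_one, one_mul]

/-- Dilation is an isometry between any two bands. -/
theorem exists_isometry_bandL2 {B B' : ℝ} (hB : 0 < B) (hB' : 0 < B') :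
    ∃ Φ : BandL2 B →L[ℂ] BandL2 B', ∀ X, ‖Φ X‖ = ‖X‖ := by
  set k := B / B' with hk
  have hk0 : 0 < k := by positivity
  let T : (ℝ → ℂ) →ₗ[ℂ] (ℝ → ℂ) :=
    { toFun := fun f x => (√k : ℂ) * f (k * x)
      map_add' := fun f g => by ext x; simp [mul_add]
      map_smul' := fun c f => by ext x; simp [mul_left_comm] }
  have hq : Measure.QuasiMeasurePreserving (k * · : ℝ → ℝ) volume volume := by
    refine ⟨by fun_prop, ?_⟩
    rw [Real.map_volume_mul_left hk0.ne']
    exact Measure.smul_absolutelyContinuous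
  have hT : ∀ f : ℝ → ℂ, ∫⁻ x, ‖T f x‖ₑ ^ 2 = ∫⁻ x, ‖f x‖ₑ ^ 2 := by
    intro f
    rw [← lintegral_comp_const_mul hk0 fun x => ‖f x‖ₑ ^ 2, ← lintegral_const_mul' _ _ ENNReal.ofReal_ne_top]
    refine lintegral_congr fun x => ?_
    change ‖(√k : ℂ) * f (k * x)‖ₑ ^ 2 = _
    rw [enorm_mul, mul_pow]
    congr 1
    rw [← ofReal_norm, Complex.norm_real, Real.norm_of_nonneg (Real.sqrt_nonneg _),
      ← ENNReal.ofReal_pow (Real.sqrt_nonneg _), Real.sq_sqrt hk0.le]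
  obtain ⟨Φ, hΦ⟩ := exists_bandL2_clm (B := B) (B' := B') T
    (fun f g h => by
      filter_upwards [hq.ae h] with x hx
      change (√k : ℂ) * f (k * x) = √k * g (k * x)
      rw [hx])
    (fun f hf => (hf.comp_quasiMeasurePreserving hq).const_mul _) zero_le_one
    (fun f _ => by rw [hT, ENNReal.ofReal_one, one_mul])
  refine ⟨Φ, fun X => ?_⟩
  -- No mass is lost by restricting to the output band, since `k * B' = B`.
  have h0 : ∀ f ∉ Icc 0 B', T X.extend f = 0 := by
    intro f hf
    change (√k : ℂ) * X.extend (k * f) = 0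
    rw [X.extend_of_notMem, mul_zero]
    contrapose! hf
    have e : f = (k * f) / k := by field_simp
    rw [e]
    refine ⟨div_nonneg hf.1 hk0.le, ?_⟩
    rw [div_le_iff₀ hk0, hk, mul_div_cancel₀ _ hB'.ne']
    exact hf.2
  have h1 := BandL2.extend_ae_eq_of_ae_eq (hΦ X) h0
  have h2 : ENNReal.ofReal (‖Φ X‖ ^ 2) = ENNReal.ofReal (‖X‖ ^ 2) := by
    rw [BandL2.ofReal_norm_sq, BandL2.ofReal_norm_sq, ← hT X.extend]
    refine lintegral_congr_ae ?_
    filter_upwards [h1] with x hx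
    rw [hx]
  rw [ENNReal.ofReal_eq_ofReal_iff (by positivity) (by positivity)] at h2
  exact (pow_left_inj₀ (norm_nonneg _) (norm_nonneg _) two_ne_zero).1 h2

end dilation

/-! ### Block decomposition and the mixing operator -/

section blocks

theorem setLIntegral_Ico_const_add (c b : ℝ) (g : ℝ → ENNReal) :
    ∫⁻ x in Ico 0 b, g (c + x) = ∫⁻ x in Ico c (c + b), g x := by
  have h := (measurePreserving_add_left volume c).setLIntegral_comp_preimage_emb
    (measurableEmbedding_addLeft c) g (Ico c (c + b))
  simpa using h

theorem setLIntegral_Ico_eq_sum_blocks {b : ℝ} (hb : 0 ≤ b) (N : ℕ) (g : ℝ → ENNReal) :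
    ∫⁻ x in Ico 0 (N * b), g x = ∑ j : Fin N, ∫⁻ x in Ico 0 b, g ((j : ℕ) * b + x) := by
  induction N with
  | zero => simp
  | succ N ih =>
    have hu : Ico (0 : ℝ) ((N + 1 : ℕ) * b) = Ico 0 (N * b) ∪ Ico (N * b) (N * b + b) := by
      rw [Ico_union_Ico_eq_Ico (by positivity) (by linarith)]
      push_cast
      ring_nf
    rw [hu, lintegral_union measurableSet_Ico (by
      rw [Set.disjoint_left]
      intro x h1 h2
      exact absurd h1.2 (not_lt.2 h2.1)), ih, Fin.sum_univ_castSucc, ← setLIntegral_Ico_const_add]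
    rfl

/-- The spectrum mixing operator of the matrix `G`, on functions. -/
noncomputable def mixing {M N : ℕ} (b : ℝ) (G : Matrix (Fin M) (Fin N) ℝ) :
    (ℝ → ℂ) →ₗ[ℂ] (ℝ → ℂ) where
  toFun g x := ∑ i : Fin M, (Ico ((i : ℕ) * b) ((i : ℕ) * b + b)).indicator
    (fun x => ∑ j : Fin N, (G i j : ℂ) * g ((j : ℕ) * b + (x - (i : ℕ) * b))) x
  map_add' g h := by
    ext x
    simp only [Pi.add_apply]
    rw [← Finset.sum_add_distrib]
    refine Finset.sum_congr rfl fun i _ => ?_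
    by_cases hx : x ∈ Ico ((i : ℕ) * b) ((i : ℕ) * b + b)
    · simp only [indicator_of_mem hx, mul_add, Finset.sum_add_distrib]
    · simp only [indicator_of_notMem hx, add_zero]
  map_smul' c g := by
    ext x
    simp only [Pi.smul_apply, smul_eq_mul, RingHom.id_apply, Finset.mul_sum]
    refine Finset.sum_congr rfl fun i _ => ?_
    by_cases hx : x ∈ Ico ((i : ℕ) * b) ((i : ℕ) * b + b)
    · simp only [indicator_of_mem hx, Finset.mul_sum, mul_left_comm]
    · simp only [indicator_of_notMem hx, mul_zero]

variable {M N : ℕ} {b : ℝ} (G : Matrix (Fin M) (Fin N) ℝ)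

theorem mixing_block (g : ℝ → ℂ) (i : Fin M) {x : ℝ} (hx : x ∈ Ico 0 b) :
    mixing b G g ((i : ℕ) * b + x) = ∑ j, (G i j : ℂ) * g ((j : ℕ) * b + x) := by
  have hb : 0 < b := hx.1.trans_lt hx.2
  change ∑ i' : Fin M, indicator _ _ _ = _
  rw [Finset.sum_eq_single i]
  · have hxi : (i : ℕ) * b + x ∈ Ico ((i : ℕ) * b) ((i : ℕ) * b + b) :=
      ⟨by linarith [hx.1], by linarith [hx.2]⟩
    rw [indicator_of_mem hxi]
    simp
  · intro i' _ hne
    refine indicator_of_notMem (fun h => hne ?_) _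
    have h1 : ((i' : ℕ) : ℝ) < (i : ℕ) + 1 := by
      refine lt_of_mul_lt_mul_right ?_ hb.le
      linarith [h.1, hx.2]
    have h2 : ((i : ℕ) : ℝ) < (i' : ℕ) + 1 := by
      refine lt_of_mul_lt_mul_right ?_ hb.le
      linarith [h.2, hx.1]
    norm_cast at h1 h2
    omega
  · simp

theorem mixing_of_notMem (hb : 0 ≤ b) (g : ℝ → ℂ) {x : ℝ} (hx : x ∉ Ico 0 (M * b)) :
    mixing b G g x = 0 := by
  change ∑ i' : Fin M, indicator _ _ _ = _
  refine Finset.sum_eq_zero fun i _ => indicator_of_notMem (fun h => hx ⟨?_, ?_⟩) _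
  · exact le_trans (by positivity) h.1
  · have : ((i : ℕ) : ℝ) + 1 ≤ M := by exact_mod_cast i.2
    have : (((i : ℕ) : ℝ) + 1) * b ≤ M * b := by gcongr
    linarith [h.2]

theorem mixing_congr_ae {g h : ℝ → ℂ} (hgh : g =ᵐ[volume] h) :
    mixing b G g =ᵐ[volume] mixing b G h := by
  have key : ∀ i : Fin M, ∀ j : Fin N, ∀ᵐ x : ℝ,
      g ((j : ℕ) * b + (x - (i : ℕ) * b)) = h ((j : ℕ) * b + (x - (i : ℕ) * b)) := fun i j =>
    (((measurePreserving_add_left volume ((j : ℕ) * b)).comp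
      (measurePreserving_sub_right volume ((i : ℕ) * b))).quasiMeasurePreserving).ae hgh
  have key' := ae_all_iff.2 fun i => ae_all_iff.2 (key i)
  filter_upwards [key'] with x hx
  change ∑ i' : Fin M, indicator _ _ _ = ∑ i' : Fin M, indicator _ _ _
  refine Finset.sum_congr rfl fun i _ => ?_
  simp only [indicator, hx]

theorem aestronglyMeasurable_mixing {g : ℝ → ℂ} (hg : AEStronglyMeasurable g volume) :
    AEStronglyMeasurable (mixing b G g) volume := by
  change AEStronglyMeasurable (fun x => ∑ i : Fin M,
    (Ico ((i : ℕ) * b) ((i : ℕ) * b + b)).indicator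
      (fun x => ∑ j : Fin N, (G i j : ℂ) * g ((j : ℕ) * b + (x - (i : ℕ) * b))) x) volume
  refine Finset.aestronglyMeasurable_fun_sum _ fun i _ => ?_
  refine AEStronglyMeasurable.indicator ?_ measurableSet_Ico
  refine Finset.aestronglyMeasurable_fun_sum _ fun j _ => ?_
  refine AEStronglyMeasurable.const_mul ?_ _
  exact hg.comp_quasiMeasurePreserving ((measurePreserving_add_left volume ((j : ℕ) * b)).comp
      (measurePreserving_sub_right volume ((i : ℕ) * b))).quasiMeasurePreserving

theorem aemeasurable_enorm_sq_const_add {g : ℝ → ℂ} (hg : AEStronglyMeasurable g volume) (c : ℝ)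
    (s : Set ℝ) : AEMeasurable (fun x => ‖g (c + x)‖ₑ ^ 2) (volume.restrict s) :=
  ((hg.comp_quasiMeasurePreserving
    (measurePreserving_add_left volume c).quasiMeasurePreserving).enorm.pow_const 2).restrict

theorem setLIntegral_enorm_sq_eq_blocks (hb : 0 ≤ b) (N : ℕ) {g : ℝ → ℂ}
    (hg : AEStronglyMeasurable g volume) :
    ∫⁻ x in Ico 0 (N * b), ‖g x‖ₑ ^ 2 =
      ∫⁻ x in Ico 0 b, ∑ j : Fin N, ‖g ((j : ℕ) * b + x)‖ₑ ^ 2 := by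
  rw [setLIntegral_Ico_eq_sum_blocks hb, lintegral_finsetSum']
  exact fun j _ => aemeasurable_enorm_sq_const_add hg _ _

theorem lintegral_enorm_sq_eq_blocks (hb : 0 ≤ b) {g : ℝ → ℂ} (hg : AEStronglyMeasurable g volume)
    (h0 : ∀ x ∉ Icc 0 (N * b), g x = 0) :
    ∫⁻ x, ‖g x‖ₑ ^ 2 = ∫⁻ x in Ico 0 b, ∑ j : Fin N, ‖g ((j : ℕ) * b + x)‖ₑ ^ 2 := by
  rw [← setLIntegral_enorm_sq_eq_blocks hb N hg, setLIntegral_congr Ico_ae_eq_Icc,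
    ← lintegral_indicator measurableSet_Icc]
  refine lintegral_congr fun x => ?_
  by_cases hx : x ∈ Icc 0 (N * b)
  · rw [indicator_of_mem hx]
  · rw [indicator_of_notMem hx, h0 x hx]; simp

theorem lintegral_enorm_sq_mixing (hb : 0 ≤ b) {g : ℝ → ℂ} (hg : AEStronglyMeasurable g volume) :
    ∫⁻ x, ‖mixing b G g x‖ₑ ^ 2 =
      ∫⁻ x in Ico 0 b, ∑ i : Fin M, ‖∑ j, (G i j : ℂ) * g ((j : ℕ) * b + x)‖ₑ ^ 2 := by
  rw [lintegral_enorm_sq_eq_blocks (N := M) hb (aestronglyMeasurable_mixing G hg) fun x hx =>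
    mixing_of_notMem G hb g fun h => hx (Ico_subset_Icc_self h)]
  refine setLIntegral_congr_fun measurableSet_Ico fun x hx => ?_
  refine Finset.sum_congr rfl fun i _ => ?_
  rw [mixing_block G g i hx]

theorem sum_enorm_sq {ι : Type*} (s : Finset ι) (v : ι → ℂ) :
    ∑ j ∈ s, ‖v j‖ₑ ^ 2 = ENNReal.ofReal (∑ j ∈ s, ‖v j‖ ^ 2) := by
  rw [ENNReal.ofReal_sum_of_nonneg fun _ _ => by positivity]
  refine Finset.sum_congr rfl fun j _ => ?_
  rw [ENNReal.ofReal_pow (norm_nonneg _), ofReal_norm]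

/-- Crude Hilbert–Schmidt bound, needed only for continuity of the mixing operator. -/
theorem sum_norm_sq_mulVec_le (v : Fin N → ℂ) :
    ∑ i, ‖∑ j, (G i j : ℂ) * v j‖ ^ 2 ≤ (∑ i, ∑ j, G i j ^ 2) * ∑ j, ‖v j‖ ^ 2 := by
  rw [Finset.sum_mul]
  refine Finset.sum_le_sum fun i _ => ?_
  calc ‖∑ j, (G i j : ℂ) * v j‖ ^ 2 ≤ (∑ j, |G i j| * ‖v j‖) ^ 2 := by
        gcongr
        refine (norm_sum_le _ _).trans_eq ?_
        simp
    _ ≤ (∑ j, |G i j| ^ 2) * ∑ j, ‖v j‖ ^ 2 := Finset.sum_mul_sq_le_sq_mul_sq _ _ _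
    _ = _ := by simp

theorem exists_isSpectrumMixing {B B' : ℝ} (hb : 0 < b) (hMb : M * b ≤ B')
    (G : Matrix (Fin M) (Fin ⌈B / b⌉₊) ℝ) :
    ∃ Φ : BandL2 B →L[ℂ] BandL2 B', IsSpectrumMixing b G Φ := by
  obtain ⟨Φ, hΦ⟩ := exists_bandL2_clm (B := B) (B' := B') (mixing b G)
    (fun f g => mixing_congr_ae G) (fun f => aestronglyMeasurable_mixing G)
    (K := ∑ i, ∑ j, G i j ^ 2) (by positivity) (fun f hf => by
      rw [lintegral_enorm_sq_mixing G hb.le hf]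
      refine le_trans ?_ (mul_le_mul_right (setLIntegral_le_lintegral (Ico 0 (⌈B / b⌉₊ * b)) _) _)
      rw [setLIntegral_enorm_sq_eq_blocks hb.le _ hf,
        ← lintegral_const_mul' _ _ ENNReal.ofReal_ne_top]
      refine lintegral_mono fun x => ?_
      rw [sum_enorm_sq, sum_enorm_sq, ← ENNReal.ofReal_mul (by positivity)]
      exact ENNReal.ofReal_le_ofReal (sum_norm_sq_mulVec_le G _))
  have hext : ∀ X, (Φ X).extend =ᵐ[volume] mixing b G X.extend := fun X =>
    BandL2.extend_ae_eq_of_ae_eq (hΦ X) fun f hf => mixing_of_notMem G hb.le _ fun h =>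
      hf ⟨h.1, h.2.le.trans hMb⟩
  refine ⟨Φ, hb, hMb, fun X => ⟨fun i => ?_, ?_⟩⟩
  · have h := (measurePreserving_add_left volume ((i : ℕ) * b)).quasiMeasurePreserving.ae (hext X)
    filter_upwards [ae_restrict_of_ae h, ae_restrict_mem measurableSet_Ico] with x hx hxb
    rw [hx, mixing_block G _ i hxb]
  · filter_upwards [hext X] with x hx hlt
    rw [hx, mixing_of_notMem G hb.le _ fun h => (h.2.trans hlt).false]

/-- The squared norms of a spectrum and of the mixed spectrum, by blocks. -/
theorem IsSpectrumMixing.ofReal_norm_sq {B B' : ℝ} {G : Matrix (Fin M) (Fin ⌈B / b⌉₊) ℝ}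
    {Φ : BandL2 B →L[ℂ] BandL2 B'} (h : IsSpectrumMixing b G Φ) (X : BandL2 B) :
    ENNReal.ofReal (‖Φ X‖ ^ 2) =
      ∫⁻ x in Ico 0 b, ∑ i : Fin M, ‖∑ j, (G i j : ℂ) * X.extend ((j : ℕ) * b + x)‖ₑ ^ 2 := by
  obtain ⟨hb, hMb, hX⟩ := h
  rw [BandL2.ofReal_norm_sq]
  have h1 : ∫⁻ x, ‖(Φ X).extend x‖ₑ ^ 2 = ∫⁻ x in Ico 0 (M * b), ‖(Φ X).extend x‖ₑ ^ 2 := by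
    rw [setLIntegral_congr Ico_ae_eq_Icc, ← lintegral_indicator measurableSet_Icc]
    refine lintegral_congr_ae ?_
    filter_upwards [(hX X).2] with x hx
    by_cases hxM : x ∈ Icc 0 (M * b)
    · rw [indicator_of_mem hxM]
    rw [indicator_of_notMem hxM]
    rcases lt_or_ge x 0 with h0 | h0
    · rw [(Φ X).extend_of_notMem fun h => absurd h.1 (not_le.2 h0)]; simp
    · rw [hx (by by_contra hle; exact hxM ⟨h0, not_lt.1 hle⟩)]; simp
  rw [h1, setLIntegral_enorm_sq_eq_blocks hb.le M (Φ X).aestronglyMeasurable_extend]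
  refine lintegral_congr_ae ?_
  filter_upwards [ae_all_iff.2 (hX X).1] with x hx
  simp only [hx]

theorem BandL2.ofReal_norm_sq_eq_blocks {B : ℝ} (hb : 0 < b) (X : BandL2 B) :
    ENNReal.ofReal (‖X‖ ^ 2) =
      ∫⁻ x in Ico 0 b, ∑ j : Fin ⌈B / b⌉₊, ‖X.extend ((j : ℕ) * b + x)‖ₑ ^ 2 := by
  rw [BandL2.ofReal_norm_sq, lintegral_enorm_sq_eq_blocks hb.le X.aestronglyMeasurable_extend]
  intro x hx
  refine X.extend_of_notMem fun h => hx ⟨h.1, h.2.trans ?_⟩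
  rw [← div_le_iff₀ hb]
  exact Nat.le_ceil _

end blocks

/-! ### Sparsity of the fibres -/

section sparse

/-- A union of `n` intervals of measure at most `n * b` meets at most `3 * n` blocks of length
`b`. -/
theorem card_blocks_le {n N : ℕ} {b : ℝ} (hb : 0 < b) {S : Set ℝ} (hS : IsIntervalUnion n S)
    (hvol : volume S ≤ ENNReal.ofReal (n * b)) (J : Finset (Fin N))
    (hJ : ∀ j ∈ J, ∃ x ∈ Ico 0 b, ((j : ℕ) : ℝ) * b + x ∈ S) : J.card ≤ 3 * n := by
  classical
  obtain ⟨l, u, rfl⟩ := hS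
  let I : Fin N → Set ℝ := fun j => Ico ((j : ℕ) * b) ((j : ℕ) * b + b)
  set S := ⋃ i, Icc (l i) (u i) with hSdef
  -- Indices of the blocks holding an end point. A negative end point has floor `0`, which may add a
  -- spurious index but does not affect the count.
  let E : Finset ℕ := Finset.univ.image (fun i => ⌊l i / b⌋₊) ∪
    Finset.univ.image (fun i => ⌊u i / b⌋₊)
  have hE : E.card ≤ 2 * n := by
    refine (Finset.card_union_le _ _).trans ?_
    have h1 := Finset.card_image_le (s := Finset.univ) (f := fun i : Fin n => ⌊l i / b⌋₊)
    have h2 := Finset.card_image_le (s := Finset.univ) (f := fun i : Fin n => ⌊u i / b⌋₊)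
    simp only [Finset.card_univ, Fintype.card_fin] at h1 h2
    omega
  have hfloor : ∀ (j : Fin N) (y : ℝ), y ∈ I j → ⌊y / b⌋₊ = j := by
    intro j y hy
    rw [Nat.floor_eq_iff (div_nonneg (le_trans (by positivity) hy.1) hb.le), le_div_iff₀ hb,
      div_lt_iff₀ hb]
    exact ⟨hy.1, by linarith [hy.2]⟩
  let J₁ : Finset (Fin N) := J.filter fun j : Fin N => (j : ℕ) ∈ E
  let J₂ : Finset (Fin N) := J.filter fun j : Fin N => (j : ℕ) ∉ E
  have hJ₁ : J₁.card ≤ 2 * n := by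
    refine (Finset.card_le_card_of_injOn (fun j : Fin N => (j : ℕ))
      (fun j hj => (Finset.mem_filter.1 hj).2) fun _ _ _ _ h => Fin.ext h).trans hE
  have hsub : ∀ j ∈ J₂, I j ⊆ S := by
    intro j hj
    obtain ⟨hjJ, hjE⟩ := Finset.mem_filter.1 hj
    obtain ⟨x, hx, hxS⟩ := hJ j hjJ
    obtain ⟨i, hi⟩ := mem_iUnion.1 hxS
    have hl : l i ∉ I j := fun h => hjE (Finset.mem_union_left _
      (Finset.mem_image.2 ⟨i, Finset.mem_univ _, hfloor j _ h⟩))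
    have hu : u i ∉ I j := fun h => hjE (Finset.mem_union_right _
      (Finset.mem_image.2 ⟨i, Finset.mem_univ _, hfloor j _ h⟩))
    have hl' : l i < (j : ℕ) * b := by
      by_contra h
      exact hl ⟨not_lt.1 h, by linarith [hi.1, hx.2]⟩
    have hu' : (j : ℕ) * b + b ≤ u i := by
      by_contra h
      exact hu ⟨by linarith [hi.2, hx.1], not_le.1 h⟩
    intro y hy
    exact mem_iUnion.2 ⟨i, by linarith [hy.1], by linarith [hy.2]⟩
  have hdisj : Set.PairwiseDisjoint (J₂ : Set (Fin N)) I := by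
    intro j _ j' _ hne
    rw [Function.onFun, Set.disjoint_left]
    intro y hy hy'
    exact hne (Fin.ext ((hfloor j y hy).symm.trans (hfloor j' y hy')))
  have hJ₂ : J₂.card ≤ n := by
    have h1 : volume (⋃ j ∈ J₂, I j) ≤ ENNReal.ofReal (n * b) :=
      (measure_mono (iUnion₂_subset hsub)).trans hvol
    rw [measure_biUnion_finset hdisj fun _ _ => measurableSet_Ico] at h1
    have h2 : ∀ j ∈ J₂, volume (I j) = ENNReal.ofReal b := fun j _ => by
      rw [Real.volume_Ico, add_sub_cancel_left]
    rw [Finset.sum_congr rfl h2, Finset.sum_const, nsmul_eq_mul, ← ENNReal.ofReal_natCast,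
      ← ENNReal.ofReal_mul (by positivity), ENNReal.ofReal_le_ofReal_iff (by positivity)] at h1
    exact_mod_cast le_of_mul_le_mul_right h1 hb
  have : J₁.card + J₂.card = J.card := Finset.card_filter_add_card_filter_not _
  omega

/-- The reflected support `-S` meets the positive band at most in the null set `{0}`. -/
theorem extend_eq_zero_of_isSignalSpectrum {B : ℝ} {S : Set ℝ} {X : BandL2 B} (hS : S ⊆ Icc 0 B)
    (hX : IsSignalSpectrum B S X) : ∀ᵐ f, f ∉ S → X.extend f = 0 := by
  obtain ⟨x, -, h1, h2⟩ := hX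
  rw [ae_restrict_iff' measurableSet_Icc] at h2
  filter_upwards [h1, h2, Measure.ae_ne volume (0 : ℝ)] with f h1 h2 h0 hfS
  by_cases hf : f ∈ Icc 0 B
  · rw [BandL2.extend, indicator_of_mem hf, h2 hf]
    refine h1 hfS fun h => h0 ?_
    linarith [(hS h).1, hf.1]
  · exact X.extend_of_notMem hf

theorem exists_card_le_of_mem_sparseSpectra {B σ : ℝ} {n N : ℕ} (hσ : 0 < σ) (hn : 1 ≤ n)
    {X : BandL2 B} (hX : X ∈ sparseSpectra B σ n) :
    ∃ J : Finset (Fin N), J.card ≤ 3 * n ∧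
      ∀ᵐ x ∂(volume.restrict (Ico 0 (σ / n))), ∀ j ∉ J,
        X.extend ((j : ℕ) * (σ / n) + x) = 0 := by
  classical
  obtain ⟨S, hS, hSB, hvol, hXS⟩ := hX
  have hn0 : (0 : ℝ) < n := by exact_mod_cast hn
  have hb : 0 < σ / n := by positivity
  refine ⟨Finset.univ.filter fun j => ∃ x ∈ Ico 0 (σ / n), ((j : ℕ) : ℝ) * (σ / n) + x ∈ S,
    card_blocks_le hb hS (by rwa [mul_div_cancel₀ _ hn0.ne']) _ (by simp), ?_⟩
  have h : ∀ j : Fin N, ∀ᵐ x : ℝ, ((j : ℕ) : ℝ) * (σ / n) + x ∉ S →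
      X.extend ((j : ℕ) * (σ / n) + x) = 0 := fun j =>
    (measurePreserving_add_left volume _).quasiMeasurePreserving.ae
      (extend_eq_zero_of_isSignalSpectrum hSB hXS)
  filter_upwards [ae_restrict_of_ae (ae_all_iff.2 h), ae_restrict_mem measurableSet_Ico]
    with x hx hxb j hj
  refine hx j fun hxS => hj ?_
  simp only [Finset.mem_filter, Finset.mem_univ, true_and]
  exact ⟨x, hxb, hxS⟩

end sparse

/-! ### Assembly -/

theorem IsSpectrumMixing.isBiLipschitzOn {B B' σ α β : ℝ} {n M : ℕ} (hσ : 0 < σ) (hn : 1 ≤ n)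
    (hα : 0 < α) (hαβ : α ≤ β) {G : Matrix (Fin M) (Fin ⌈B / (σ / n)⌉₊) ℝ}
    (hG : ∀ v : Fin ⌈B / (σ / n)⌉₊ → ℂ,
      (Finset.univ.filter fun j => v j ≠ 0).card ≤ 6 * n →
      α * ∑ j, ‖v j‖ ^ 2 ≤ ∑ i, ‖∑ j, (G i j : ℂ) * v j‖ ^ 2 ∧
      ∑ i, ‖∑ j, (G i j : ℂ) * v j‖ ^ 2 ≤ β * ∑ j, ‖v j‖ ^ 2)
    {Φ : BandL2 B →L[ℂ] BandL2 B'} (hΦ : IsSpectrumMixing (σ / n) G Φ) :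
    IsBiLipschitzOn Φ (sparseSpectra B σ n) α β := by
  classical
  refine ⟨hα, hαβ, fun X₁ hX₁ X₂ hX₂ => ?_⟩
  have hβ : 0 ≤ β := hα.le.trans hαβ
  obtain ⟨J₁, hc₁, hJ₁⟩ := exists_card_le_of_mem_sparseSpectra (N := ⌈B / (σ / n)⌉₊) hσ hn hX₁
  obtain ⟨J₂, hc₂, hJ₂⟩ := exists_card_le_of_mem_sparseSpectra (N := ⌈B / (σ / n)⌉₊) hσ hn hX₂
  have hsub : ∀ j : Fin ⌈B / (σ / n)⌉₊, ∀ᵐ x : ℝ, (X₁ - X₂).extend ((j : ℕ) * (σ / n) + x) =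
      (X₁.extend - X₂.extend) ((j : ℕ) * (σ / n) + x) := fun j =>
    (measurePreserving_add_left volume _).quasiMeasurePreserving.ae (X₁.extend_sub X₂)
  have key : ∀ᵐ x ∂(volume.restrict (Ico 0 (σ / n))), (Finset.univ.filter fun
      j : Fin ⌈B / (σ / n)⌉₊ => (X₁ - X₂).extend ((j : ℕ) * (σ / n) + x) ≠ 0).card ≤ 6 * n := by
    filter_upwards [hJ₁, hJ₂, ae_restrict_of_ae (ae_all_iff.2 hsub)] with x h1 h2 h3
    have : (Finset.univ.filter fun
      j : Fin ⌈B / (σ / n)⌉₊ => (X₁ - X₂).extend ((j : ℕ) * (σ / n) + x) ≠ 0) ⊆ J₁ ∪ J₂ := by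
      intro j
      simp only [Finset.mem_filter, Finset.mem_univ, true_and, Finset.mem_union]
      contrapose!
      rintro ⟨hj1, hj2⟩
      rw [h3 j, Pi.sub_apply, h1 j hj1, h2 j hj2, sub_zero]
    have h4 := Finset.card_le_card this
    have h5 := Finset.card_union_le J₁ J₂
    omega
  constructor
  · rw [← ENNReal.ofReal_le_ofReal_iff (by positivity), ENNReal.ofReal_mul hα.le,
      hΦ.ofReal_norm_sq, BandL2.ofReal_norm_sq_eq_blocks hΦ.1,
      ← lintegral_const_mul' _ _ ENNReal.ofReal_ne_top]
    refine lintegral_mono_ae ?_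
    filter_upwards [key] with x hx
    rw [sum_enorm_sq, sum_enorm_sq, ← ENNReal.ofReal_mul hα.le]
    exact ENNReal.ofReal_le_ofReal (hG _ hx).1
  · rw [← ENNReal.ofReal_le_ofReal_iff (by positivity), ENNReal.ofReal_mul hβ,
      hΦ.ofReal_norm_sq, BandL2.ofReal_norm_sq_eq_blocks hΦ.1,
      ← lintegral_const_mul' _ _ ENNReal.ofReal_ne_top]
    refine lintegral_mono_ae ?_
    filter_upwards [key] with x hx
    rw [sum_enorm_sq, sum_enorm_sq, ← ENNReal.ofReal_mul hβ]
    exact ENNReal.ofReal_le_ofReal (hG _ hx).2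

theorem mainTheorem4 :
    ∃ c α β : ℝ, 0 < c ∧ 0 < α ∧ α ≤ β ∧
      ∀ B_N B_M σ : ℝ, 0 < σ → σ < B_N → c * σ * Real.log (B_N / σ) ≤ B_M →
        (∃ Φ : BandL2 B_N →L[ℂ] BandL2 B_M,
          IsBiLipschitzOn Φ (⋃ n : ℕ, sparseSpectra B_N σ n) α β) ∧
        (2 * σ ≤ B_N → ∀ n : ℕ, 1 ≤ n →
          ∃ (M : ℕ) (G : Matrix (Fin M) (Fin ⌈B_N / (σ / n)⌉₊) ℝ)
            (Φ : BandL2 B_N →L[ℂ] BandL2 B_M),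
            IsSpectrumMixing (σ / n) G Φ ∧
            IsBiLipschitzOn Φ (sparseSpectra B_N σ n) α β) := by
  -- The surplus of `1302` over `1300` absorbs the floor in `M`, because `2 n log r > 1`. The values
  -- `1 / 100` and `9` are the squares of `1 / 10` and `3`.
  refine ⟨1302, 1 / 100, 9, by norm_num, by norm_num, by norm_num, fun B_N B_M σ hσ hσN hB => ?_⟩
  have hN0 : 0 < B_N := hσ.trans hσN
  have hlog : 0 < Real.log (B_N / σ) := Real.log_pos ((one_lt_div hσ).2 hσN)
  have hM0 : 0 < B_M := lt_of_lt_of_le (by positivity) hB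
  constructor
  · obtain ⟨Φ, hΦ⟩ := exists_isometry_bandL2 hN0 hM0
    refine ⟨Φ, by norm_num, by norm_num, fun x₁ _ x₂ _ => ?_⟩
    rw [hΦ]
    constructor <;> linarith [sq_nonneg ‖x₁ - x₂‖]
  · intro h2σ n hn
    have hn1 : (1 : ℝ) ≤ n := by exact_mod_cast hn
    have hn0 : (0 : ℝ) < n := by linarith
    have hb : 0 < σ / n := by positivity
    have hr : 2 ≤ B_N / σ := by rwa [le_div_iff₀ hσ]
    have hlog2 : 0.69 < Real.log (B_N / σ) := by
      have := Real.log_le_log (by norm_num) hr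
      linarith [Real.log_two_gt_d9]
    have e1 : B_N / (σ / n) = n * (B_N / σ) := by field_simp
    -- The ceiling costs at most `1 ≤ n r`.
    have hN : (⌈B_N / (σ / n)⌉₊ : ℝ) ≤ 2 * n * (B_N / σ) := by
      have := Nat.ceil_lt_add_one (a := B_N / (σ / n)) (by positivity)
      rw [e1] at this ⊢
      nlinarith
    set M := ⌊1302 * n * Real.log (B_N / σ)⌋₊ with hMdef
    have hM : 1300 * n * Real.log (B_N / σ) ≤ M := by
      have := Nat.lt_floor_add_one (1302 * n * Real.log (B_N / σ))
      rw [← hMdef] at this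
      nlinarith
    have hMb : M * (σ / n) ≤ B_M := by
      have h1 : (M : ℝ) ≤ 1302 * n * Real.log (B_N / σ) := Nat.floor_le (by positivity)
      calc M * (σ / n) ≤ 1302 * n * Real.log (B_N / σ) * (σ / n) := by gcongr
        _ = 1302 * σ * Real.log (B_N / σ) := by field_simp
        _ ≤ B_M := hB
    obtain ⟨G, hG⟩ := exists_matrix_restricted_isometry hn hr hN hM
    obtain ⟨Φ, hΦ⟩ := exists_isSpectrumMixing hb hMb G
    exact ⟨M, G, Φ, hΦ, hΦ.isBiLipschitzOn hσ hn (by norm_num) (by norm_num) hG⟩
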